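/- Let $\mathbb{O}$ be the octonions, and let $\mathbb{O}\mathbb{P}^2$ be the octonionic projective plane, i.e. the set of Hermitian $3\times 3$ matrices $\Pi$ over $\mathbb{O}$ with $\Pi^2=\Pi$ and $\operatorname{Tr}\Pi=1$, with $\langle \Pi,\Pi'\rangle=\operatorname{Re}\operatorname{Tr}(\Pi\Pi')$, chordal distance $\rho(\Pi,\Pi')=\|\Pi-\Pi'\|_F/\sqrt2$ and geodesic distance $\vartheta\in[0,\pi]$ given by $\cos\vartheta(\Pi,\Pi')=2\langle\Pi,\Pi'\rangle-1$. Let $C_k=P_k^{(7,3)}$ be the Jacobi polynomials (the zonal spherical functions of $\mathbb{O}\mathbb{P}^2$), and let $V_k$ be the space of harmonics of degree $k$, spanned by the functions $x\mapsto C_k(\cos\vartheta(x,y))$ with $y\in\mathbb{O}\mathbb{P}^2$. A code is a finite subset $\mathcal{C}\subset\mathbb{O}\mathbb{P}^2$. * $\mathcal{C}$ is a $t$-design if $\sum_{x\in\mathcal{C}}f(x)=0$ for all $f\in V_k$, $0<k\le t$. * $\mathcal{C}$ is tight if a linear programming bound is sharp for it: there are $\theta\in[0,\pi]$ and $f=\sum_{k=0}^n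 f_kC_k$ with $f_0>0$, $f_k\ge0$ for $1\le k\le n$, and $f\le0$ on $[-1,\cos\theta]$, such that distinct points of $\mathcal{C}$ have geodesic distance at least $\theta$ and $|\mathcal{C}|=f(1)/f_0$. * $\mathcal{C}$ is universally optimal if for every completely monotonic function $f$ on $(0,1]$ (that is, $f$ is $C^\infty$ and $(-1)^kf^{(k)}\ge0$ on $(0,1]$ for all $k\ge0$), $\mathcal{C}$ minimizes $\sum_{x\ne y}f(\rho(x,y)^2)$ among all codes of $|\mathcal{C}|$ points. * A system of mutually unbiased bases in $\mathbb{O}\mathbb{P}^2$ is a family of orthogonal triples of points (triples with pairwise inner product $0$) such that any two points of different triples have inner product $1/3$. Write $\mathbb{O}=\mathbb{H}\oplus\mathbb{H}\ell$ with $\ell$ a standard octonion unit orthogonal to $\mathbb{H}=\operatorname{span}\{1,i,j,k\}$, and put $n=j\ell$, $\omega=e^{2\pi i/3}\in\operatorname{span}\{1,i\}$. Let $\mathcal{C}\subset\mathbb{O}\mathbb{P}^2$ consist of the matrices $vv^\dagger$ where $v$ is one of the three standard basis vectors or one of $$\tfrac{1}{\sqrt3}(1,\omega^a,\omega^b),\quad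 \tfrac{1}{\sqrt3}(1,\omega^aj,\omega^b\ell),\quad \tfrac{1}{\sqrt3}(1,\omega^a\ell,\omega^bn),\quad \tfrac{1}{\sqrt3}(1,\omega^an,\omega^bj)\qquad(a,b\in\{0,1,2\}).$$ **Theorem.** $\mathcal{C}$ is a tight code of $39$ points in $\mathbb{O}\mathbb{P}^2$. It is the disjoint union of $13$ orthogonal triples such that any two points in distinct triples satisfy $\langle\Pi,\Pi'\rangle=1/3$, i.e. $\rho(\Pi,\Pi')=\sqrt{2/3}$. These triples form a system of $13$ mutually unbiased bases, and no system of mutually unbiased bases in $\mathbb{O}\mathbb{P}^2$ has more than $13$ bases. Moreover, $\mathcal{C}$ is a $2$-design and is universally optimal. -/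

import Mathlib

open scoped Quaternion ContDiff

noncomputable section

/-- The real octonions, by Cayley-Dickson doubling of Hamilton's quaternions: the pair `⟨a, b⟩`
stands for `a + b ℓ`. -/
@[ext]
structure Octonion where
  fst : ℍ[ℝ]
  snd : ℍ[ℝ]

namespace Octonion

instance : Zero Octonion := ⟨⟨0, 0⟩⟩
instance : One Octonion := ⟨⟨1, 0⟩⟩
instance : Add Octonion := ⟨fun x y => ⟨x.fst + y.fst, x.snd + y.snd⟩⟩
instance : Neg Octonion := ⟨fun x => ⟨-x.fst, -x.snd⟩⟩
instance : Sub Octonion := ⟨fun x y => ⟨x.fst - y.fst, x.snd - y.snd⟩⟩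
instance : SMul ℝ Octonion := ⟨fun r x => ⟨r • x.fst, r • x.snd⟩⟩

/-- `(a, b) (c, d) = (a c - d̄ b, d a + b c̄)`. -/
instance : Mul Octonion :=
  ⟨fun x y => ⟨x.fst * y.fst - star y.snd * x.snd, y.snd * x.fst + x.snd * star y.fst⟩⟩

/-- Octonionic conjugation `(a, b) ↦ (ā, -b)`. -/
instance : Star Octonion := ⟨fun x => ⟨star x.fst, -x.snd⟩⟩

@[simp] theorem fst_zero : (0 : Octonion).fst = 0 := rfl
@[simp] theorem snd_zero : (0 : Octonion).snd = 0 := rfl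
@[simp] theorem fst_one : (1 : Octonion).fst = 1 := rfl
@[simp] theorem snd_one : (1 : Octonion).snd = 0 := rfl
@[simp] theorem fst_add (x y : Octonion) : (x + y).fst = x.fst + y.fst := rfl
@[simp] theorem snd_add (x y : Octonion) : (x + y).snd = x.snd + y.snd := rfl
@[simp] theorem fst_neg (x : Octonion) : (-x).fst = -x.fst := rfl
@[simp] theorem snd_neg (x : Octonion) : (-x).snd = -x.snd := rfl
@[simp] theorem fst_sub (x y : Octonion) : (x - y).fst = x.fst - y.fst := rfl
@[simp] theorem snd_sub (x y : Octonion) : (x - y).snd = x.snd - y.snd := rfl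
@[simp] theorem fst_smul (r : ℝ) (x : Octonion) : (r • x).fst = r • x.fst := rfl
@[simp] theorem snd_smul (r : ℝ) (x : Octonion) : (r • x).snd = r • x.snd := rfl
@[simp] theorem fst_mul (x y : Octonion) :
    (x * y).fst = x.fst * y.fst - star y.snd * x.snd := rfl
@[simp] theorem snd_mul (x y : Octonion) :
    (x * y).snd = y.snd * x.fst + x.snd * star y.fst := rfl
@[simp] theorem fst_star (x : Octonion) : (star x).fst = star x.fst := rfl
@[simp] theorem snd_star (x : Octonion) : (star x).snd = -x.snd := rfl

instance : AddCommGroup Octonion where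
  add_assoc x y z := by ext1 <;> simp [add_assoc]
  zero_add x := by ext1 <;> simp
  add_zero x := by ext1 <;> simp
  neg_add_cancel x := by ext1 <;> simp
  add_comm x y := by ext1 <;> simp [add_comm]
  sub_eq_add_neg x y := by ext1 <;> simp [sub_eq_add_neg]
  nsmul := nsmulRec
  zsmul := zsmulRec

instance : NonAssocRing Octonion where
  left_distrib x y z := by ext1 <;> simp [mul_add, add_mul] <;> abel
  right_distrib x y z := by ext1 <;> simp [mul_add, add_mul] <;> abel
  zero_mul x := by ext1 <;> simp
  mul_zero x := by ext1 <;> simp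
  one_mul x := by ext1 <;> simp
  mul_one x := by ext1 <;> simp

instance : Module ℝ Octonion where
  one_smul x := by ext1 <;> simp
  mul_smul r s x := by ext1 <;> simp [mul_smul]
  smul_zero r := by ext1 <;> simp
  smul_add r x y := by ext1 <;> simp
  add_smul r s x := by ext1 <;> simp [add_smul]
  zero_smul x := by ext1 <;> simp

/-- The real part of an octonion. -/
def re (x : Octonion) : ℝ := x.fst.re

/-- The squared norm `|x|² = |a|² + |b|²`. -/
def normSq (x : Octonion) : ℝ := Quaternion.normSq x.fst + Quaternion.normSq x.snd

/-- The complex numbers as the span of `1, i` in the octonions. -/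
def ofComplex (z : ℂ) : Octonion := ⟨(z : ℍ[ℝ]), 0⟩

/-- The quaternion unit `j`. -/
def unitJ : Octonion := ⟨⟨0, 0, 1, 0⟩, 0⟩

/-- The octonion unit `ℓ`, orthogonal to the quaternions. -/
def unitL : Octonion := ⟨0, 1⟩

/-- The octonion unit `n = j ℓ`. -/
def unitN : Octonion := unitJ * unitL

end Octonion

/-- `3 × 3` matrices over the octonions. -/
abbrev OctMatrix := Matrix (Fin 3) (Fin 3) Octonion

/-- The octonionic projective plane: Hermitian `3 × 3` matrices `Π` over the octonions with
`Π² = Π` and trace `1`. -/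
def OP2 : Type := {A : OctMatrix // A.IsHermitian ∧ A * A = A ∧ A.trace = 1}

namespace OP2

/-- `⟨Π₁, Π₂⟩ = Re Tr (Π₁ Π₂)`. -/
def innerProd (x y : OP2) : ℝ := (x.1 * y.1).trace.re

/-- The chordal distance `ρ(Π₁, Π₂) = ‖Π₁ - Π₂‖_F / √2`. -/
def chordalDist (x y : OP2) : ℝ :=
  Real.sqrt (∑ i, ∑ j, (x.1 i j - y.1 i j).normSq) / Real.sqrt 2

/-- The geodesic distance `ϑ`, normalized so that the greatest distance is `π`:
`cos ϑ = 2 ⟨Π₁, Π₂⟩ - 1` with `ϑ ∈ [0, π]`. -/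
def geodesicDist (x y : OP2) : ℝ := Real.arccos (2 * innerProd x y - 1)

end OP2

/-- The Jacobi polynomial `P_n^{(α,β)}(z) =
∑ₛ binom(n+α, n-s) binom(n+β, s) ((z-1)/2)^s ((z+1)/2)^(n-s)`. -/
def jacobiP (α β n : ℕ) (z : ℝ) : ℝ :=
  ∑ s ∈ Finset.range (n + 1),
    ((n + α).choose (n - s) : ℝ) * ((n + β).choose s : ℝ) *
      ((z - 1) / 2) ^ s * ((z + 1) / 2) ^ (n - s)

/-- The zonal spherical functions `C_k = P_k^{(7,3)}` of the octonionic projective plane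
(`dim_ℝ OP² / 2 - 1 = 7` and `dim_ℝ 𝕆 / 2 - 1 = 3`); `C_0 = 1`. -/
def zonal (k : ℕ) (z : ℝ) : ℝ := jacobiP 7 3 k z

/-- The space `V_k` of harmonics of degree `k`, the irreducible component of `L²(OP²)` whose
reproducing kernel is (up to scaling) `C_k(cos ϑ(x, y))`: it is spanned by the kernel functions
`x ↦ C_k(cos ϑ(x, y))`. -/
def harmonics (k : ℕ) : Submodule ℝ (OP2 → ℝ) :=
  Submodule.span ℝ (Set.range fun y : OP2 => fun x : OP2 => zonal k (Real.cos (x.geodesicDist y)))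

/-- A `t`-design: all harmonics of degree `1, …, t` sum to zero over the code. -/
def IsDesign (t : ℕ) (C : Finset OP2) : Prop :=
  ∀ k, 0 < k → k ≤ t → ∀ f ∈ harmonics k, ∑ x ∈ C, f x = 0

/-- The code is tight: some linear programming bound is sharp for it. That is, for some
`θ ∈ [0, π]` and some `f = ∑_{k ≤ n} c_k C_k` with `c_0 > 0`, `c_k ≥ 0` and `f ≤ 0` on
`[-1, cos θ]` (so that codes of minimal geodesic distance at least `θ` have at most `f(1) / c_0`
points), the code has minimal geodesic distance at least `θ` and exactly `f(1) / c_0` points. -/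
def IsTightCode (C : Finset OP2) : Prop :=
  ∃ θ ∈ Set.Icc 0 Real.pi, ∃ (n : ℕ) (c : ℕ → ℝ),
    0 < c 0 ∧ (∀ k, 1 ≤ k → k ≤ n → 0 ≤ c k) ∧
    (∀ z ∈ Set.Icc (-1) (Real.cos θ), ∑ k ∈ Finset.range (n + 1), c k * zonal k z ≤ 0) ∧
    (∀ x ∈ C, ∀ y ∈ C, x ≠ y → θ ≤ x.geodesicDist y) ∧
    (C.card : ℝ) = (∑ k ∈ Finset.range (n + 1), c k * zonal k 1) / c 0

/-- Completely monotonic functions on `(0, 1]`, the range of the squared chordal distance between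
distinct points. -/
def IsCompletelyMonotonic (f : ℝ → ℝ) : Prop :=
  ContDiffOn ℝ ∞ f (Set.Ioc 0 1) ∧
    ∀ k : ℕ, ∀ r ∈ Set.Ioc (0 : ℝ) 1, 0 ≤ (-1) ^ k * iteratedDerivWithin k f (Set.Ioc 0 1) r

open scoped Classical in
/-- The potential energy of a code for the potential `f` of squared chordal distance. -/
def energy (f : ℝ → ℝ) (C : Finset OP2) : ℝ :=
  ∑ p ∈ C.offDiag, f (p.1.chordalDist p.2 ^ 2)

/-- The code minimizes energy among all codes of the same size, for every completely monotonic
function of squared chordal distance. -/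
def IsUniversallyOptimal (C : Finset OP2) : Prop :=
  ∀ f : ℝ → ℝ, IsCompletelyMonotonic f →
    ∀ D : Finset OP2, D.card = C.card → energy f C ≤ energy f D

/-- A system of mutually unbiased bases in `OP²`: each basis `b i` consists of three pairwise
orthogonal points, and points of different bases have inner product `1/3`. -/
def IsMUBSystem {ι : Type*} (b : ι → Fin 3 → OP2) : Prop :=
  (∀ i s t, s ≠ t → (b i s).innerProd (b i t) = 0) ∧
    ∀ i j, i ≠ j → ∀ s t, (b i s).innerProd (b j t) = 1 / 3

/-- The matrix `v v†` of a vector `v` of octonions. -/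
def rankOne (v : Fin 3 → Octonion) : OctMatrix := Matrix.of fun i j => v i * star (v j)

/-- The octonion `ω ^ a` with `ω = exp(2πi/3)` in the span of `1, i`. -/
def omegaPow (a : ℕ) : Octonion :=
  Octonion.ofComplex (Complex.exp (2 * Real.pi * Complex.I / 3) ^ a)

/-- The pairs `(p, q)` of units in the four families of vectors `(1, ω^a p, ω^b q) / √3`. -/
def unitPairs : Fin 4 → Octonion × Octonion :=
  ![(1, 1), (Octonion.unitJ, Octonion.unitL), (Octonion.unitL, Octonion.unitN),
    (Octonion.unitN, Octonion.unitJ)]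

/-- The matrices `v v†`, for `v` a standard basis vector or one of the vectors
`(1, ω^a, ω^b) / √3`, `(1, ω^a j, ω^b ℓ) / √3`, `(1, ω^a ℓ, ω^b n) / √3`, `(1, ω^a n, ω^b j) / √3`
with `a, b = 0, 1, 2`. -/
def explicitMatrices : Set OctMatrix :=
  (Set.range fun i : Fin 3 => rankOne (Pi.single i 1)) ∪
    {A | ∃ (m : Fin 4) (a b : Fin 3),
      A = rankOne ((1 / Real.sqrt 3) •
        ![1, omegaPow a * (unitPairs m).1, omegaPow b * (unitPairs m).2])}

end

/-! Subtracting `1/3` from a point of `OP²` puts it in the 26-dimensional Euclidean space of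
traceless Hermitian matrices, where the inner product becomes `⟨Π,Π'⟩ - 1/3` (`coord_dotProduct`).
Two inequalities hold for every code: the sum of its vectors has nonnegative square norm, and the
second-moment (Welch) bound `sq_sum_dotProduct_le` holds in dimension 26. They take the place of the
positive definiteness of `C_1` and `C_2`.

For `n` mutually unbiased bases the second inequality reads `(2n)² ≤ 26 · 3n · (2/3)`, so `n ≤ 13`.
For 13 bases both inequalities are equalities: the vectors sum to zero and form a tight frame, which
is the 2-design property. For universal optimality, a completely monotonic potential of `1 - t` lies
above the quadratic in `t` touching it at `t = 0` and doubly at `t = 1/3`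
(`exists_quadratic_minorant`). Its Newton coefficients are nonnegative, so the two inequalities
bound the energy from below (`le_energy`), with equality when all inner products are `0` or `1/3`.
This needs `⟨Π,Π'⟩ ≥ 0`, which comes from the identity `mul_innerProd`.

The explicit code is checked by splitting `𝕆` into four orthogonal complex lines through `1, j, ℓ,
n`. Points of different families have only vanishing cross terms; within a family the inner products
are read off from the parallel classes of lines in the affine plane over `𝔽₃`. -/

/-! ### Octonion algebra: composition, alternativity and adjoints. -/

namespace Octonion

/-- The Euclidean inner product of octonions. -/
def dot (x y : Octonion) : ℝ :=
  x.fst.re * y.fst.re + x.fst.imI * y.fst.imI + x.fst.imJ * y.fst.imJ + x.fst.imK * y.fst.imK +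
    (x.snd.re * y.snd.re + x.snd.imI * y.snd.imI + x.snd.imJ * y.snd.imJ + x.snd.imK * y.snd.imK)

theorem dot_comm (x y : Octonion) : dot x y = dot y x := by simp only [dot]; ring

theorem dot_add_left (x y z : Octonion) : dot (x + y) z = dot x z + dot y z := by
  simp [dot]; ring

theorem dot_add_right (x y z : Octonion) : dot x (y + z) = dot x y + dot x z := by
  simp [dot]; ring

theorem dot_smul_left (r : ℝ) (x y : Octonion) : dot (r • x) y = r * dot x y := by
  simp [dot]; ring

theorem dot_smul_right (r : ℝ) (x y : Octonion) : dot x (r • y) = r * dot x y := by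
  simp [dot]; ring

theorem dot_self (x : Octonion) : dot x x = x.normSq := by
  simp [dot, normSq, Quaternion.normSq_def']; ring

theorem normSq_nonneg (x : Octonion) : 0 ≤ x.normSq :=
  add_nonneg Quaternion.normSq_nonneg Quaternion.normSq_nonneg

theorem normSq_eq_zero {x : Octonion} (h : x.normSq = 0) : x = 0 := by
  have h1 : 0 ≤ Quaternion.normSq x.fst := Quaternion.normSq_nonneg
  have h2 : 0 ≤ Quaternion.normSq x.snd := Quaternion.normSq_nonneg
  simp only [normSq] at h
  ext1
  · exact Quaternion.normSq_eq_zero.1 (by linarith)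
  · exact Quaternion.normSq_eq_zero.1 (by linarith)

theorem re_mul (x y : Octonion) : (x * y).re = dot x (star y) := by
  simp [re, dot]; ring

theorem dot_star_star (x y : Octonion) : dot (star x) (star y) = dot x y := by
  simp [dot]

/-- Multiplication by `y` and by `star y` are adjoint. With the alternative laws below, this
replaces associativity. -/
theorem dot_mul_right (x y z : Octonion) : dot (x * y) z = dot x (z * star y) := by
  simp [dot]; ring

theorem dot_mul_left (x y z : Octonion) : dot (x * y) z = dot y (star x * z) := by
  simp [dot]; ring

theorem normSq_mul (x y : Octonion) : (x * y).normSq = x.normSq * y.normSq := by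
  simp [normSq, Quaternion.normSq_def']; ring

theorem normSq_star (x : Octonion) : (star x).normSq = x.normSq := by
  simp [normSq]

theorem normSq_one : (1 : Octonion).normSq = 1 := by simp [normSq]

theorem star_star' (x : Octonion) : star (star x) = x := by ext1 <;> simp

theorem star_mul' (x y : Octonion) : star (x * y) = star y * star x := by
  ext1 <;> simp

theorem star_smul' (r : ℝ) (x : Octonion) : star (r • x) = r • star x := by
  ext1 <;> simp

theorem star_one' : star (1 : Octonion) = 1 := by ext1 <;> simp

theorem star_zero' : star (0 : Octonion) = 0 := by ext1 <;> simp

theorem smul_mul (r : ℝ) (x y : Octonion) : (r • x) * y = r • (x * y) := by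
  ext1 <;> simp [smul_sub]

theorem mul_smul' (r : ℝ) (x y : Octonion) : x * (r • y) = r • (x * y) := by
  ext1 <;> simp [smul_sub]

theorem mul_star_self (x : Octonion) : x * star x = x.normSq • 1 := by
  ext <;> simp [normSq, Quaternion.normSq_def'] <;> ring

theorem star_mul_self (x : Octonion) : star x * x = x.normSq • 1 := by
  ext <;> simp [normSq, Quaternion.normSq_def'] <;> ring

theorem star_mul_mul (x y : Octonion) : star x * (x * y) = x.normSq • y := by
  ext <;> simp [normSq, Quaternion.normSq_def'] <;> ring

theorem mul_mul_star (x y : Octonion) : (x * y) * star y = y.normSq • x := by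
  ext <;> simp [normSq, Quaternion.normSq_def'] <;> ring

theorem mul_star_mul_self (x y : Octonion) : (x * star y) * y = y.normSq • x := by
  simpa [star_star', normSq_star] using mul_mul_star x (star y)

/-- The squared norm of a sum of three octonions. -/
theorem normSq_add_add (x y z : Octonion) :
    (x + y + z).normSq =
      x.normSq + y.normSq + z.normSq + 2 * dot x y + 2 * dot x z + 2 * dot y z := by
  simp only [← dot_self, dot_add_left, dot_add_right]
  rw [dot_comm y x, dot_comm z x, dot_comm z y]; ring

theorem eq_re_smul_one {x : Octonion} (h : star x = x) : x = x.re • 1 := by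
  have h1 := congrArg fst h
  have h2 := congrArg snd h
  simp only [fst_star, snd_star] at h1 h2
  have e1 : x.fst.imI = 0 := by have := congrArg (·.imI) h1; simp at this; linarith
  have e2 : x.fst.imJ = 0 := by have := congrArg (·.imJ) h1; simp at this; linarith
  have e3 : x.fst.imK = 0 := by have := congrArg (·.imK) h1; simp at this; linarith
  have e4 : x.snd.re = 0 := by have := congrArg (·.re) h2; simp at this; linarith
  have e5 : x.snd.imI = 0 := by have := congrArg (·.imI) h2; simp at this; linarith
  have e6 : x.snd.imJ = 0 := by have := congrArg (·.imJ) h2; simp at this; linarith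
  have e7 : x.snd.imK = 0 := by have := congrArg (·.imK) h2; simp at this; linarith
  ext <;> simp [re, e1, e2, e3, e4, e5, e6, e7]

end Octonion

/-! ### The Welch bound and its equality case. -/

/-- The second-moment defect of a finite family `u`, `∑ₐᵦ (∑ᵢ uᵢₐ uᵢᵦ - r δₐᵦ)²`. -/
theorem sum_sq_moment_sub {ι κ : Type*} [Fintype ι] [DecidableEq ι] (s : Finset κ)
    (u : κ → ι → ℝ) (r : ℝ) :
    ∑ a, ∑ b, (∑ i ∈ s, u i a * u i b - if a = b then r else 0) ^ 2 =
      ∑ i ∈ s, ∑ j ∈ s, (u i ⬝ᵥ u j) ^ 2 - 2 * r * ∑ i ∈ s, u i ⬝ᵥ u i +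
        Fintype.card ι * r ^ 2 := by
  have h1 : ∑ a, ∑ b, (∑ i ∈ s, u i a * u i b) ^ 2 = ∑ i ∈ s, ∑ j ∈ s, (u i ⬝ᵥ u j) ^ 2 := by
    simp only [dotProduct, pow_two, Finset.sum_mul_sum]
    simp_rw [Finset.sum_comm (s := Finset.univ) (t := s)]
    refine Finset.sum_congr rfl fun i _ => Finset.sum_congr rfl fun j _ =>
      Finset.sum_congr rfl fun a _ => Finset.sum_congr rfl fun b _ => by ring
  have h2 : ∑ a, ∑ i ∈ s, u i a * u i a = ∑ i ∈ s, u i ⬝ᵥ u i := by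
    rw [Finset.sum_comm]; rfl
  simp_rw [sub_sq, Finset.sum_add_distrib, Finset.sum_sub_distrib, h1, ← h2]
  simp [Finset.mul_sum, mul_comm, mul_left_comm]

/-- The defect is a sum of squares; the best `r` is the mean eigenvalue `T / card ι` of the moment
matrix, whose trace is `T`. -/
theorem sq_sum_dotProduct_le {ι κ : Type*} [Fintype ι] [Nonempty ι] (s : Finset κ)
    (u : κ → ι → ℝ) :
    (∑ i ∈ s, u i ⬝ᵥ u i) ^ 2 ≤ Fintype.card ι * ∑ i ∈ s, ∑ j ∈ s, (u i ⬝ᵥ u j) ^ 2 := by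
  classical
  have hd : (0 : ℝ) < Fintype.card ι := by exact_mod_cast Fintype.card_pos
  set T := ∑ i ∈ s, u i ⬝ᵥ u i
  have h := sum_sq_moment_sub s u (T / Fintype.card ι)
  have h0 : 0 ≤ ∑ a, ∑ b, (∑ i ∈ s, u i a * u i b -
      if a = b then T / Fintype.card ι else 0) ^ 2 := by positivity
  rw [h] at h0
  have : (Fintype.card ι : ℝ) * (T / Fintype.card ι) ^ 2 = T * (T / Fintype.card ι) := by
    field_simp
  rw [this] at h0
  have h3 : T * (T / Fintype.card ι) ≤ ∑ i ∈ s, ∑ j ∈ s, (u i ⬝ᵥ u j) ^ 2 := by linarith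
  rw [← mul_div_assoc, div_le_iff₀ hd] at h3
  nlinarith

/-- A family attaining equality in `sq_sum_dotProduct_le` is a tight frame. -/
theorem sum_sq_dotProduct_eq {ι κ : Type*} [Fintype ι] (s : Finset κ)
    (u : κ → ι → ℝ) (r : ℝ) (h : ∑ i ∈ s, ∑ j ∈ s, (u i ⬝ᵥ u j) ^ 2 = Fintype.card ι * r ^ 2)
    (h' : ∑ i ∈ s, u i ⬝ᵥ u i = Fintype.card ι * r) (y : ι → ℝ) :
    ∑ i ∈ s, (u i ⬝ᵥ y) ^ 2 = r * (y ⬝ᵥ y) := by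
  classical
  have h0 := sum_sq_moment_sub s u r
  rw [h, h'] at h0
  have h1 : ∑ a, ∑ b, (∑ i ∈ s, u i a * u i b - if a = b then r else 0) ^ 2 = 0 := by
    rw [h0]; ring
  have h2 : ∀ a b, ∑ i ∈ s, u i a * u i b = if a = b then r else 0 := by
    intro a b
    rw [Finset.sum_eq_zero_iff_of_nonneg fun _ _ => by positivity] at h1
    have h3 := h1 a (Finset.mem_univ _)
    rw [Finset.sum_eq_zero_iff_of_nonneg fun _ _ => by positivity] at h3
    have h4 := h3 b (Finset.mem_univ _)
    exact sub_eq_zero.1 (pow_eq_zero_iff two_ne_zero |>.1 h4)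
  calc ∑ i ∈ s, (u i ⬝ᵥ y) ^ 2
      = ∑ a, ∑ b, (∑ i ∈ s, u i a * u i b) * (y a * y b) := by
        simp only [dotProduct, pow_two, Finset.sum_mul, Finset.mul_sum]
        simp_rw [Finset.sum_comm (s := Finset.univ) (t := s)]
        refine Finset.sum_congr rfl fun i _ =>
          Finset.sum_congr rfl fun a _ => Finset.sum_congr rfl fun b _ => by ring
    _ = r * (y ⬝ᵥ y) := by
        simp [h2, dotProduct, Finset.mul_sum]

/-! ### Quadratic minorants of completely monotonic functions. -/

namespace IsCompletelyMonotonic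

open Set

variable {f : ℝ → ℝ}

theorem hasDerivAt_iteratedDerivWithin (hf : IsCompletelyMonotonic f) (k : ℕ) {r : ℝ}
    (hr : r ∈ Ioo (0 : ℝ) 1) :
    HasDerivAt (iteratedDerivWithin k f (Ioc 0 1))
      (iteratedDerivWithin (k + 1) f (Ioc 0 1) r) r := by
  have hd : DifferentiableOn ℝ (iteratedDerivWithin k f (Ioc 0 1)) (Ioc 0 1) :=
    hf.1.differentiableOn_iteratedDerivWithin (by exact_mod_cast WithTop.coe_lt_top _)
      (uniqueDiffOn_Ioc 0 1)
  have h := (hd r (Ioo_subset_Ioc_self hr)).hasDerivWithinAt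
  rw [iteratedDerivWithin_succ]
  exact h.hasDerivAt (Ioc_mem_nhds hr.1 hr.2)

theorem continuousOn_iteratedDerivWithin (hf : IsCompletelyMonotonic f) (k : ℕ) :
    ContinuousOn (iteratedDerivWithin k f (Ioc 0 1)) (Ioc 0 1) :=
  hf.1.continuousOn_iteratedDerivWithin (by exact_mod_cast le_top) (uniqueDiffOn_Ioc 0 1)

theorem antitoneOn_of_even (hf : IsCompletelyMonotonic f) {k : ℕ} (hk : Even k) :
    AntitoneOn (iteratedDerivWithin k f (Ioc 0 1)) (Ioc 0 1) := by
  refine antitoneOn_of_deriv_nonpos (convex_Ioc 0 1) (hf.continuousOn_iteratedDerivWithin k)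
    ?_ ?_ <;> rw [interior_Ioc]
  · exact fun r hr => (hf.hasDerivAt_iteratedDerivWithin k hr).differentiableAt.differentiableWithinAt
  · intro r hr
    rw [(hf.hasDerivAt_iteratedDerivWithin k hr).deriv]
    have := hf.2 (k + 1) r (Ioo_subset_Ioc_self hr)
    rw [hk.add_one.neg_one_pow] at this
    linarith

theorem monotoneOn_of_odd (hf : IsCompletelyMonotonic f) {k : ℕ} (hk : Odd k) :
    MonotoneOn (iteratedDerivWithin k f (Ioc 0 1)) (Ioc 0 1) := by
  refine monotoneOn_of_deriv_nonneg (convex_Ioc 0 1) (hf.continuousOn_iteratedDerivWithin k)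
    ?_ ?_ <;> rw [interior_Ioc]
  · exact fun r hr => (hf.hasDerivAt_iteratedDerivWithin k hr).differentiableAt.differentiableWithinAt
  · intro r hr
    rw [(hf.hasDerivAt_iteratedDerivWithin k hr).deriv]
    have := hf.2 (k + 1) r (Ioo_subset_Ioc_self hr)
    rw [hk.add_one.neg_one_pow] at this
    linarith

theorem concaveOn_of_odd (hf : IsCompletelyMonotonic f) {k : ℕ} (hk : Odd k) :
    ConcaveOn ℝ (Ioc 0 1) (iteratedDerivWithin k f (Ioc 0 1)) := by
  refine AntitoneOn.concaveOn_of_deriv (convex_Ioc 0 1) (hf.continuousOn_iteratedDerivWithin k)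
    ?_ ?_ <;> rw [interior_Ioc]
  · exact fun r hr => (hf.hasDerivAt_iteratedDerivWithin k hr).differentiableAt.differentiableWithinAt
  · intro r hr s hs hrs
    rw [(hf.hasDerivAt_iteratedDerivWithin k hr).deriv,
      (hf.hasDerivAt_iteratedDerivWithin k hs).deriv]
    exact hf.antitoneOn_of_even hk.add_one (Ioo_subset_Ioc_self hr) (Ioo_subset_Ioc_self hs) hrs

theorem hasDerivAt (hf : IsCompletelyMonotonic f) {r : ℝ} (hr : r ∈ Ioo (0 : ℝ) 1) :
    HasDerivAt f (iteratedDerivWithin 1 f (Ioc 0 1) r) r := by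
  simpa using hf.hasDerivAt_iteratedDerivWithin 0 hr

/-- A function with concave derivative lies above a quadratic polynomial that agrees with it at the
right end point and to second order at an interior point. -/
theorem _root_.nonneg_of_concaveOn_deriv {e e' : ℝ → ℝ} {m b : ℝ} (hm : m ∈ Ioo 0 b)
    (hc : ContinuousOn e (Ioc 0 b)) (hd : ∀ r ∈ Ioo 0 b, HasDerivAt e (e' r) r)
    (hcc : ConcaveOn ℝ (Ioc 0 b) e') (h0 : e m = 0) (h1 : e b = 0) (h2 : e' m = 0)
    {r : ℝ} (hr : r ∈ Ioc 0 b) : 0 ≤ e r := by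
  -- Rolle gives a second zero `c` of `e'`. By concavity `e'` is nonnegative on `[m, c]` and
  -- nonpositive outside, so `e` falls to `0` at `m`, rises up to `c`, and falls again to `0` at
  -- `b`.
  obtain ⟨c, hcm, hc0⟩ : ∃ c ∈ Ioo m b, e' c = 0 :=
    exists_hasDerivAt_eq_zero hm.2 (hc.mono fun x hx => ⟨hm.1.trans_le hx.1, hx.2⟩)
      (h0.trans h1.symm) fun x hx => hd x ⟨hm.1.trans hx.1, hx.2⟩
  have hb : 0 < b := hm.1.trans hm.2
  have hmI : m ∈ Ioc 0 b := ⟨hm.1, hm.2.le⟩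
  have hcI : c ∈ Ioc 0 b := ⟨hm.1.trans hcm.1, hcm.2.le⟩
  rcases le_total r m with hrm | hrm
  · have : AntitoneOn e (Icc r m) := by
      refine antitoneOn_of_deriv_nonpos (convex_Icc r m)
        (hc.mono fun x hx => ⟨hr.1.trans_le hx.1, hx.2.trans hm.2.le⟩) ?_ ?_ <;>
        rw [interior_Icc]
      · exact fun x hx => (hd x ⟨hr.1.trans hx.1,
          hx.2.trans hm.2⟩).differentiableAt.differentiableWithinAt
      · intro x hx
        have hx' : x ∈ Ioo 0 b := ⟨hr.1.trans hx.1, hx.2.trans hm.2⟩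
        rw [(hd x hx').deriv]
        have := hcc.slope_anti_adjacent (Ioo_subset_Ioc_self hx') hcI hx.2 hcm.1
        rw [h2, hc0, sub_zero, zero_div, zero_sub] at this
        by_contra! hpos
        have : (-e' x) / (m - x) < 0 := div_neg_of_neg_of_pos (by linarith) (by linarith [hx.2])
        linarith
    have := this (left_mem_Icc.2 hrm) (right_mem_Icc.2 hrm) hrm
    linarith
  rcases le_total r c with hrc | hrc
  · have : MonotoneOn e (Icc m r) := by
      refine monotoneOn_of_deriv_nonneg (convex_Icc m r)
        (hc.mono fun x hx => ⟨hm.1.trans_le hx.1, hx.2.trans hr.2⟩) ?_ ?_ <;>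
        rw [interior_Icc]
      · exact fun x hx => (hd x ⟨hm.1.trans hx.1,
          hx.2.trans_le hr.2⟩).differentiableAt.differentiableWithinAt
      · intro x hx
        have hx' : x ∈ Ioo 0 b := ⟨hm.1.trans hx.1, hx.2.trans_le hr.2⟩
        rw [(hd x hx').deriv]
        have := hcc.min_le_of_mem_Icc hmI hcI ⟨hx.1.le, hx.2.le.trans hrc⟩
        simpa [h2, hc0] using this
    have := this (left_mem_Icc.2 hrm) (right_mem_Icc.2 hrm) hrm
    linarith
  · have : AntitoneOn e (Icc r b) := by
      refine antitoneOn_of_deriv_nonpos (convex_Icc r b)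
        (hc.mono fun x hx => ⟨hr.1.trans_le hx.1, hx.2⟩) ?_ ?_ <;>
        rw [interior_Icc]
      · exact fun x hx => (hd x ⟨hr.1.trans hx.1,
          hx.2⟩).differentiableAt.differentiableWithinAt
      · intro x hx
        have hx' : x ∈ Ioo 0 b := ⟨hr.1.trans hx.1, hx.2⟩
        rw [(hd x hx').deriv]
        have := hcc.slope_anti_adjacent hmI (Ioo_subset_Ioc_self hx') hcm.1 (hrc.trans_lt hx.1)
        rw [h2, hc0, sub_zero, sub_zero, zero_div] at this
        by_contra! hpos
        have : 0 < e' x / (x - c) := div_pos hpos (by linarith [hx.1])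
        linarith
    have := this (left_mem_Icc.2 hr.2) (right_mem_Icc.2 hr.2) hr.2
    linarith

/-- The quadratic polynomial, in Newton form in `t = 1 - r`, interpolating `f` at `r = 1` and to
second order at `r = 2 / 3`. -/
theorem exists_quadratic_minorant (hf : IsCompletelyMonotonic f) :
    ∃ A B D : ℝ, 0 ≤ B ∧ 0 ≤ D ∧
      (∀ t ∈ Ico (0 : ℝ) 1, A + B * t + D * (t * (t - 1 / 3)) ≤ f (1 - t)) ∧
      f 1 = A ∧ f (2 / 3) = A + B * (1 / 3) := by
  set g := iteratedDerivWithin 1 f (Ioc 0 1) with hg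
  have hm : (2 / 3 : ℝ) ∈ Ioo (0 : ℝ) 1 := by norm_num
  have h1 : (1 : ℝ) ∈ Ioc (0 : ℝ) 1 := by norm_num
  have hcont : ContinuousOn f (Ioc 0 1) := hf.1.continuousOn
  set B := 3 * (f (2 / 3) - f 1) with hB
  -- The last coefficient matches derivatives at `t = 1/3`: the quadratic has slope `B + D/3` there,
  -- and `f (1 - t)` has slope `-g (2/3)`.
  refine ⟨f 1, B, 3 * (-g (2 / 3) - B), ?_, ?_, ?_, rfl, by rw [hB]; ring⟩
  · have := hf.antitoneOn_of_even (k := 0) (by decide) (Ioo_subset_Ioc_self hm) h1 hm.2.le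
    simp only [iteratedDerivWithin_zero] at this
    linarith
  -- The chord slope `-B` equals `g c` for some `c > 2/3`, and `g` is increasing.
  · obtain ⟨c, hc, hc'⟩ := exists_hasDerivAt_eq_slope f g hm.2
      (hcont.mono fun x hx => ⟨hm.1.trans_le hx.1, hx.2⟩)
      fun x hx => hf.hasDerivAt ⟨hm.1.trans hx.1, hx.2⟩
    have := hf.monotoneOn_of_odd (k := 1) (by decide) (Ioo_subset_Ioc_self hm)
      ⟨hm.1.trans hc.1, hc.2.le⟩ hc.1.le
    rw [← hg, hc'] at this
    have e : (f 1 - f (2 / 3)) / (1 - 2 / 3) = -B := by rw [hB]; ring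
    linarith
  · intro t ht
    set D := 3 * (-g (2 / 3) - B) with hD
    have key := nonneg_of_concaveOn_deriv (m := 2 / 3) (b := 1) (r := 1 - t)
      (e := fun r => f r - (f 1 + B * (1 - r) + D * ((1 - r) * (1 - r - 1 / 3))))
      (e' := fun r => g r + (B + D * (2 * (1 - r) - 1 / 3))) hm
      (hcont.sub (by fun_prop)) ?_ ?_ ?_ ?_ ?_ ⟨by linarith [ht.2], by linarith [ht.1]⟩
    · simp only [sub_sub_cancel] at key
      linarith
    · intro r hr
      have h2 : HasDerivAt (fun r : ℝ => 1 - r) (-1) r := by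
        simpa using (hasDerivAt_id r).const_sub 1
      have h3 := ((h2.const_mul B).const_add (f 1)).add
        ((h2.mul (h2.sub_const (1 / 3))).const_mul D)
      refine ((hf.hasDerivAt hr).sub h3).congr_deriv ?_
      ring
    · refine (hf.concaveOn_of_odd (k := 1) (by decide)).add ⟨convex_Ioc 0 1, ?_⟩
      intro x _ y _ a b _ _ hab
      have : a = 1 - b := by linarith
      subst this
      simp only [smul_eq_mul]
      nlinarith
    · simp only [hB]; ring
    · simp
    · simp only [hD]; ring

end IsCompletelyMonotonic

/-! ### Entries, inner products and distances of points of `OP²`. -/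

theorem Fin.sum_eq_add_add {M : Type*} [AddCommMonoid M] (f : Fin 3 → M) {i j k : Fin 3}
    (hij : i ≠ j) (hjk : j ≠ k) (hik : i ≠ k) : ∑ l, f l = f i + f j + f k := by
  have h : (Finset.univ : Finset (Fin 3)) = {i, j, k} := by
    revert i j k; decide
  rw [h, Finset.sum_insert (by simp [hij, hik]), Finset.sum_insert (by simp [hjk]),
    Finset.sum_singleton, add_assoc]

namespace OP2

open Octonion

/-- The diagonal entries, as real numbers. -/
noncomputable def diag (x : OP2) (i : Fin 3) : ℝ := (x.1 i i).re

variable (x y : OP2)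

theorem star_apply (i j : Fin 3) : star (x.1 i j) = x.1 j i := x.2.1.apply j i

theorem apply_self (i : Fin 3) : x.1 i i = x.diag i • 1 := eq_re_smul_one (x.star_apply i i)

theorem normSq_apply_comm (i j : Fin 3) : (x.1 i j).normSq = (x.1 j i).normSq := by
  rw [← x.star_apply i j, normSq_star]

theorem dot_apply_comm (i j : Fin 3) : dot (x.1 i j) (y.1 i j) = dot (x.1 j i) (y.1 j i) := by
  rw [← x.star_apply i j, ← y.star_apply i j, dot_star_star]

theorem dot_apply_self (i : Fin 3) : dot (x.1 i i) (y.1 i i) = x.diag i * y.diag i := by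
  rw [apply_self, apply_self, dot_smul_left, dot_smul_right, dot_self, normSq_one, mul_one]

theorem innerProd_eq_sum : x.innerProd y = ∑ i, ∑ j, dot (x.1 i j) (y.1 i j) := by
  have h : ∀ u v w : Octonion, (u + v + w).re = u.re + v.re + w.re := fun u v w => by simp [re]
  simp only [innerProd, Matrix.trace, Matrix.diag_apply, Matrix.mul_apply, Fin.sum_univ_three, h,
    re_mul, star_apply]

theorem innerProd_eq {i j k : Fin 3} (hij : i ≠ j) (hjk : j ≠ k) (hik : i ≠ k) :
    x.innerProd y = x.diag i * y.diag i + x.diag j * y.diag j + x.diag k * y.diag k +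
      2 * dot (x.1 i j) (y.1 i j) + 2 * dot (x.1 j k) (y.1 j k) + 2 * dot (x.1 k i) (y.1 k i) := by
  rw [innerProd_eq_sum, Fin.sum_eq_add_add _ hij hjk hik, Fin.sum_eq_add_add _ hij hjk hik,
    Fin.sum_eq_add_add _ hij hjk hik, Fin.sum_eq_add_add _ hij hjk hik]
  simp only [dot_apply_self]
  rw [dot_apply_comm x y j i, dot_apply_comm x y k j, dot_apply_comm x y i k]
  ring

theorem innerProd_comm : x.innerProd y = y.innerProd x := by
  simp only [innerProd_eq_sum, dot_comm]

theorem sum_diag : ∑ i, x.diag i = 1 := by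
  have h := congrArg re x.2.2.2
  simp only [Matrix.trace, Matrix.diag_apply, Fin.sum_univ_three] at h
  simpa [diag, Fin.sum_univ_three, re] using h

theorem sum_mul_apply (i j : Fin 3) : ∑ k, x.1 i k * x.1 k j = x.1 i j := by
  rw [← Matrix.mul_apply, x.2.2.1]

theorem sum_normSq (i : Fin 3) : ∑ j, (x.1 i j).normSq = x.diag i := by
  have h := congrArg re (x.sum_mul_apply i i)
  simp only [Fin.sum_univ_three] at h ⊢
  rw [diag, ← h]
  simp only [← dot_self]
  nth_rw 2 [← x.star_apply 0 i, ← x.star_apply 1 i, ← x.star_apply 2 i]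
  simp only [← re_mul]
  simp [re]

theorem normSq_apply_self (i : Fin 3) : (x.1 i i).normSq = x.diag i ^ 2 := by
  rw [← dot_self, dot_apply_self, pow_two]

theorem diag_nonneg (i : Fin 3) : 0 ≤ x.diag i := by
  rw [← sum_normSq]; exact Finset.sum_nonneg fun _ _ => normSq_nonneg _

/-- The off-diagonal part of `Π² = Π`, with the trace condition eliminating two diagonal entries. -/
theorem mul_apply_eq {i j k : Fin 3} (hij : i ≠ j) (hjk : j ≠ k) (hik : i ≠ k) :
    x.1 i k * x.1 k j = x.diag k • x.1 i j := by
  have h := x.sum_mul_apply i j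
  have ht := x.sum_diag
  rw [Fin.sum_eq_add_add _ hij hjk hik] at h ht
  rw [apply_self, apply_self, smul_mul, mul_smul', one_mul, mul_one] at h
  have hk : x.diag k = 1 - x.diag i - x.diag j := by linarith
  rw [hk, eq_sub_of_add_eq' h]
  module

/-- Adding the row-norm identities for `i` and `j` and subtracting the one for `k` isolates twice
the left side. -/
theorem normSq_apply {i j : Fin 3} (hij : i ≠ j) : (x.1 i j).normSq = x.diag i * x.diag j := by
  obtain ⟨k, hjk, hik⟩ : ∃ k, j ≠ k ∧ i ≠ k := by revert i j; decide
  have ht := x.sum_diag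
  have hi := x.sum_normSq i
  have hj := x.sum_normSq j
  have hk := x.sum_normSq k
  rw [Fin.sum_eq_add_add _ hij hjk hik] at ht hi hj hk
  rw [normSq_apply_self] at hi hj hk
  rw [x.normSq_apply_comm j i] at hj
  rw [x.normSq_apply_comm k i, x.normSq_apply_comm k j] at hk
  have e : x.diag k = 1 - x.diag i - x.diag j := by linarith
  rw [e] at hk
  linarith

theorem innerProd_self : x.innerProd x = 1 := by
  simp only [innerProd_eq_sum, dot_self, sum_normSq, sum_diag]

/-- The right side is the squared norm of the `(j, i)` entry of the product `x y`. For `x = u u†`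
and `y = w w†` over an associative algebra that entry would be `u_j (u† w) w̄_i`; here adjointness
and `mul_apply_eq` evaluate the cross terms. -/
theorem mul_innerProd {i j k : Fin 3} (hij : i ≠ j) (hjk : j ≠ k) (hik : i ≠ k) :
    x.diag j * y.diag i * x.innerProd y =
      (x.diag j • y.1 j i + y.diag i • x.1 j i + x.1 j k * y.1 k i).normSq := by
  rw [normSq_add_add, normSq_mul, ← dot_self (_ • _), ← dot_self (_ • _)]
  simp only [dot_smul_left, dot_smul_right]
  have h1 : dot (y.1 j i) (x.1 j k * y.1 k i) = y.diag i * dot (x.1 j k) (y.1 j k) := by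
    rw [dot_comm, dot_mul_right, star_apply, mul_apply_eq y hjk hik.symm hij.symm, dot_smul_right]
  have h2 : dot (x.1 j i) (x.1 j k * y.1 k i) = x.diag j * dot (x.1 k i) (y.1 k i) := by
    rw [dot_comm, dot_mul_left, star_apply, mul_apply_eq x hik.symm hij hjk.symm, dot_smul_right,
      dot_comm]
  rw [h1, h2, dot_self, dot_self, normSq_apply x hjk, normSq_apply y hik.symm,
    normSq_apply x hij.symm, normSq_apply y hij.symm, innerProd_eq x y hij hjk hik,
    dot_apply_comm x y i j, dot_comm (y.1 j i)]
  ring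

theorem innerProd_nonneg : 0 ≤ x.innerProd y := by
  have hy := y.sum_diag
  have hx := x.sum_diag
  obtain ⟨i, hi⟩ : ∃ i, 0 < y.diag i := by
    by_contra! h
    linarith [Finset.sum_nonpos fun i (_ : i ∈ Finset.univ) => h i]
  by_cases hj : ∃ j, i ≠ j ∧ 0 < x.diag j
  · obtain ⟨j, hij, hj⟩ := hj
    obtain ⟨k, hjk, hik⟩ : ∃ k, j ≠ k ∧ i ≠ k := by clear hi hj; revert i j; decide
    have h := mul_innerProd x y hij hjk hik
    refine nonneg_of_mul_nonneg_right (h ▸ normSq_nonneg _) (mul_pos hj hi)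
  -- Otherwise `x` is concentrated at the diagonal position `i`, and the inner product is `x.diag i
  -- * y.diag i`.
  · push Not at hj
    obtain ⟨j, k, hij, hjk, hik⟩ : ∃ j k, i ≠ j ∧ j ≠ k ∧ i ≠ k := by clear hi hj; revert i; decide
    have e1 : x.diag j = 0 := le_antisymm (hj j hij) (x.diag_nonneg j)
    have e2 : x.diag k = 0 := le_antisymm (hj k hik) (x.diag_nonneg k)
    have z : ∀ {a b}, a ≠ b → x.diag a * x.diag b = 0 → x.1 a b = 0 := fun hab h =>
      normSq_eq_zero ((normSq_apply x hab).trans h)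
    rw [innerProd_eq x y hij hjk hik, z hij (by simp [e1]), z hjk (by simp [e1]),
      z hik.symm (by simp [e2]), e1, e2]
    have := mul_nonneg (x.diag_nonneg i) (y.diag_nonneg i)
    simpa [dot] using this

theorem sum_normSq_sub :
    ∑ i, ∑ j, (x.1 i j - y.1 i j).normSq = 2 * (1 - x.innerProd y) := by
  have h : ∀ u v : Octonion, (u - v).normSq = dot u u + dot v v - 2 * dot u v := fun u v => by
    rw [← dot_self]; simp [dot]; ring
  simp only [h, Finset.sum_add_distrib, Finset.sum_sub_distrib, ← Finset.mul_sum,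
    ← innerProd_eq_sum, innerProd_self]
  ring

theorem innerProd_le_one : x.innerProd y ≤ 1 := by
  have h := x.sum_normSq_sub y
  have : 0 ≤ ∑ i, ∑ j, (x.1 i j - y.1 i j).normSq :=
    Finset.sum_nonneg fun _ _ => Finset.sum_nonneg fun _ _ => normSq_nonneg _
  linarith

variable {x y} in
theorem innerProd_lt_one (h : x ≠ y) : x.innerProd y < 1 := by
  refine lt_of_le_of_ne (x.innerProd_le_one y) fun h1 => h (Subtype.ext ?_)
  have h2 := x.sum_normSq_sub y
  rw [h1, sub_self, mul_zero, Finset.sum_eq_zero_iff_of_nonneg fun _ _ =>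
    Finset.sum_nonneg fun _ _ => normSq_nonneg _] at h2
  ext1 i j
  have h3 := h2 i (Finset.mem_univ _)
  rw [Finset.sum_eq_zero_iff_of_nonneg fun _ _ => normSq_nonneg _] at h3
  exact sub_eq_zero.1 (normSq_eq_zero (h3 j (Finset.mem_univ _)))

theorem chordalDist_eq : x.chordalDist y = Real.sqrt (1 - x.innerProd y) := by
  rw [chordalDist, sum_normSq_sub, Real.sqrt_mul (by norm_num), mul_div_cancel_left₀ _ (by simp)]

theorem chordalDist_sq : x.chordalDist y ^ 2 = 1 - x.innerProd y := by
  rw [chordalDist_eq, Real.sq_sqrt (by linarith [x.innerProd_le_one y])]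

theorem cos_geodesicDist : Real.cos (x.geodesicDist y) = 2 * x.innerProd y - 1 :=
  Real.cos_arccos (by linarith [x.innerProd_nonneg y]) (by linarith [x.innerProd_le_one y])

/-! ### The isometric embedding into 26-dimensional Euclidean space. -/

/-- The real coordinates of an octonion. -/
noncomputable def _root_.Octonion.coord (u : Octonion) : Fin 8 → ℝ :=
  ![u.fst.re, u.fst.imI, u.fst.imJ, u.fst.imK, u.snd.re, u.snd.imI, u.snd.imJ, u.snd.imK]

theorem _root_.Octonion.coord_dotProduct (u v : Octonion) : u.coord ⬝ᵥ v.coord = dot u v := by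
  simp [coord, dot, dotProduct, Fin.sum_univ_succ]; ring

/-- Orthonormal coordinates of the traceless part `Π - 1/3`. -/
noncomputable def coord : Fin 2 ⊕ Fin 3 × Fin 8 → ℝ :=
  Sum.elim
    ![(x.diag 0 - x.diag 1) / Real.sqrt 2, (x.diag 0 + x.diag 1 - 2 * x.diag 2) / Real.sqrt 6]
    fun p => Real.sqrt 2 * (x.1 p.1 (p.1 + 1)).coord p.2

/-- The entries `(0,1), (1,2), (2,0)` represent each conjugate pair once, hence the factor `√2`. The
two diagonal coordinates omit the direction of the identity matrix, which contributes `1/3` because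
both traces are `1`. -/
theorem coord_dotProduct : x.coord ⬝ᵥ y.coord = x.innerProd y - 1 / 3 := by
  have h2 : Real.sqrt 2 ^ 2 = 2 := Real.sq_sqrt (by norm_num)
  have h6 : Real.sqrt 6 ^ 2 = 6 := Real.sq_sqrt (by norm_num)
  have hs : ∀ i : Fin 3, ∑ c : Fin 8, (Real.sqrt 2 * (x.1 i (i + 1)).coord c) *
      (Real.sqrt 2 * (y.1 i (i + 1)).coord c) = 2 * dot (x.1 i (i + 1)) (y.1 i (i + 1)) := by
    intro i
    rw [← Octonion.coord_dotProduct, dotProduct, Finset.mul_sum]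
    refine Finset.sum_congr rfl fun c _ => ?_
    linear_combination ((x.1 i (i + 1)).coord c) * ((y.1 i (i + 1)).coord c) * h2
  have hx := x.sum_diag
  have hy := y.sum_diag
  simp only [Fin.sum_univ_three] at hx hy
  rw [innerProd_eq x y (i := 0) (j := 1) (k := 2) (by decide) (by decide) (by decide)]
  simp only [dotProduct, coord, Fintype.sum_sum_type, Fintype.sum_prod_type, Sum.elim_inl,
    Sum.elim_inr, hs, Fin.sum_univ_three, Fin.sum_univ_two]
  simp only [Matrix.cons_val_zero, Matrix.cons_val_one, div_mul_div_comm, ← pow_two, h2, h6]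
  have e1 : (1 : Fin 3) + 1 = 2 := rfl
  have e2 : (2 : Fin 3) + 1 = 0 := rfl
  rw [e1, e2, zero_add, show x.diag 2 = 1 - x.diag 0 - x.diag 1 by linarith,
    show y.diag 2 = 1 - y.diag 0 - y.diag 1 by linarith]
  ring

end OP2

open OP2

/-! ### Zonal polynomials of low degree and the energy bound. -/

theorem zonal_zero (z : ℝ) : zonal 0 z = 1 := by simp [zonal, jacobiP]

theorem zonal_one (t : ℝ) : zonal 1 (2 * t - 1) = 12 * (t - 1 / 3) := by
  have h1 : Nat.choose 8 1 = 8 := rfl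
  have h2 : Nat.choose 4 1 = 4 := rfl
  simp [zonal, jacobiP, Finset.sum_range_succ, h1, h2]
  ring

theorem zonal_two (t : ℝ) :
    zonal 2 (2 * t - 1) = 91 * (t - 1 / 3) ^ 2 - 13 / 3 * (t - 1 / 3) - 14 / 9 := by
  have h1 : Nat.choose 9 2 = 36 := rfl
  have h2 : Nat.choose 5 2 = 10 := rfl
  have h3 : Nat.choose 9 1 = 9 := rfl
  have h4 : Nat.choose 5 1 = 5 := rfl
  simp [zonal, jacobiP, Finset.sum_range_succ, h1, h2, h3, h4]
  ring

theorem sum_coord_dotProduct (D E : Finset OP2) :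
    (∑ x ∈ D, x.coord) ⬝ᵥ (∑ y ∈ E, y.coord) =
      ∑ x ∈ D, ∑ y ∈ E, (x.innerProd y - 1 / 3) := by
  simp only [sum_dotProduct, dotProduct_sum, coord_dotProduct]
  exact Finset.sum_comm

theorem sum_innerProd_sub_nonneg (D : Finset OP2) :
    0 ≤ ∑ x ∈ D, ∑ y ∈ D, (x.innerProd y - 1 / 3) := by
  rw [← sum_coord_dotProduct]
  exact Finset.sum_nonneg fun _ _ => mul_self_nonneg _

/-- Every embedded point has square norm `2/3`, and `2/117 = (2/3)² / 26`. -/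
theorem card_sq_le_sum (D : Finset OP2) :
    2 / 117 * (D.card : ℝ) ^ 2 ≤ ∑ x ∈ D, ∑ y ∈ D, (x.innerProd y - 1 / 3) ^ 2 := by
  have h := sq_sum_dotProduct_le D coord
  simp only [coord_dotProduct, innerProd_self, Finset.sum_const, nsmul_eq_mul] at h
  norm_num at h
  linarith

theorem sum_offDiag_innerProd [DecidableEq OP2] (D : Finset OP2) (F : ℝ → ℝ) :
    ∑ p ∈ D.offDiag, F (p.1.innerProd p.2) =
      ∑ x ∈ D, ∑ y ∈ D, F (x.innerProd y) - D.card * F 1 := by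
  rw [← Finset.sum_product', ← Finset.diag_union_offDiag D,
    Finset.sum_union (Finset.disjoint_diag_offDiag D), Finset.sum_diag]
  simp [innerProd_self]

theorem energy_eq (f : ℝ → ℝ) (D : Finset OP2) :
    energy f D = ∑ x ∈ D, ∑ y ∈ D, f (1 - x.innerProd y) - D.card * f 0 := by
  classical
  have h := sum_offDiag_innerProd D fun t => f (1 - t)
  simp only [sub_self] at h
  rw [← h, energy]
  simp only [chordalDist_sq]

/-- The linear programming bound for energy given by a quadratic minorant of the potential. -/
theorem le_energy {f : ℝ → ℝ} {A B G : ℝ} (hB : 0 ≤ B) (hG : 0 ≤ G)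
    (h : ∀ t ∈ Set.Ico (0 : ℝ) 1, A + B * t + G * (t * (t - 1 / 3)) ≤ f (1 - t))
    (D : Finset OP2) :
    (A + B / 3 + G * (2 / 117)) * D.card ^ 2 - (A + B + G * (2 / 3)) * D.card ≤ energy f D := by
  classical
  have h1 : ∑ p ∈ D.offDiag, (A + B * p.1.innerProd p.2 +
      G * (p.1.innerProd p.2 * (p.1.innerProd p.2 - 1 / 3))) ≤ energy f D := by
    have : energy f D = ∑ p ∈ D.offDiag, f (1 - p.1.innerProd p.2) := by
      rw [energy]; simp only [chordalDist_sq]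
    rw [this]
    refine Finset.sum_le_sum fun p hp => h _ ⟨innerProd_nonneg _ _, innerProd_lt_one ?_⟩
    exact (Finset.mem_offDiag.1 hp).2.2
  rw [sum_offDiag_innerProd D fun t => A + B * t + G * (t * (t - 1 / 3))] at h1
  -- Expansion in powers of `s = t - 1/3`, where `t (t - 1/3) = s² + s/3`; the coefficients of `s`
  -- and `s²` are nonnegative.
  have h2 : ∑ x ∈ D, ∑ y ∈ D, (A + B * x.innerProd y +
      G * (x.innerProd y * (x.innerProd y - 1 / 3))) =
      (A + B / 3) * D.card ^ 2 + (B + G / 3) * ∑ x ∈ D, ∑ y ∈ D, (x.innerProd y - 1 / 3) +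
        G * ∑ x ∈ D, ∑ y ∈ D, (x.innerProd y - 1 / 3) ^ 2 := by
    have e : (A + B / 3) * (D.card : ℝ) ^ 2 = ∑ x ∈ D, ∑ y ∈ D, (A + B / 3) := by
      simp; ring
    rw [e]
    simp only [Finset.mul_sum, ← Finset.sum_add_distrib]
    refine Finset.sum_congr rfl fun x _ => Finset.sum_congr rfl fun y _ => by ring
  rw [h2] at h1
  have h3 := mul_nonneg (show 0 ≤ B + G / 3 by positivity) (sum_innerProd_sub_nonneg D)
  have h4 := mul_le_mul_of_nonneg_left (card_sq_le_sum D) hG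
  linarith

/-! ### Consequences of the distance distribution of mutually unbiased bases. -/

namespace IsMUBSystem

section

variable {ι : Type*} {b : ι → Fin 3 → OP2}

theorem sum_comp_innerProd [Fintype ι] (hb : IsMUBSystem b) (F : ℝ → ℝ) (i : ι) (s : Fin 3) :
    ∑ j, ∑ t, F ((b i s).innerProd (b j t)) =
      F 1 + 2 * F 0 + 3 * (Fintype.card ι - 1) * F (1 / 3) := by
  classical
  have h0 : ∀ j, j ≠ i → ∑ t, F ((b i s).innerProd (b j t)) = 3 * F (1 / 3) := by
    intro j hj
    simp only [hb.2 i j hj.symm]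
    simp
  obtain ⟨t, u, hst, htu, hsu⟩ : ∃ t u, s ≠ t ∧ t ≠ u ∧ s ≠ u := by clear * -; revert s; decide
  rw [← Finset.add_sum_erase _ _ (Finset.mem_univ i),
    Finset.sum_congr rfl fun j hj => h0 j (Finset.ne_of_mem_erase hj),
    Fin.sum_eq_add_add _ hst htu hsu, hb.1 i s t hst, hb.1 i s u hsu, innerProd_self,
    Finset.sum_const, Finset.card_erase_of_mem (Finset.mem_univ i), nsmul_eq_mul,
    Nat.cast_sub (Finset.card_pos.2 ⟨i, Finset.mem_univ i⟩), Finset.card_univ]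
  push_cast
  ring

theorem injective (hb : IsMUBSystem b) : Function.Injective fun p : ι × Fin 3 => b p.1 p.2 := by
  rintro ⟨i, s⟩ ⟨j, t⟩ (h : b i s = b j t)
  have h1 : (b i s).innerProd (b j t) = 1 := by rw [h, innerProd_self]
  by_cases hij : i = j
  · subst hij
    by_cases hst : s = t
    · rw [hst]
    · rw [hb.1 i s t hst] at h1; norm_num at h1
  · rw [hb.2 i j hij] at h1; norm_num at h1

theorem card_le [Fintype ι] (hb : IsMUBSystem b) : Fintype.card ι ≤ 13 := by
  have h := sq_sum_dotProduct_le Finset.univ fun p : ι × Fin 3 => (b p.1 p.2).coord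
  simp only [coord_dotProduct, Fintype.sum_prod_type,
    hb.sum_comp_innerProd fun t => (t - 1 / 3) ^ 2, innerProd_self] at h
  simp only [Finset.sum_const, nsmul_eq_mul, Finset.card_univ, Fintype.card_fin,
    Fintype.card_sum, Fintype.card_prod] at h
  have h' : (Fintype.card ι : ℝ) ≤ 13 := by
    norm_num at h
    by_contra! hlt
    nlinarith
  exact_mod_cast h'

end

variable {b : Fin 13 → Fin 3 → OP2} {C : Finset OP2}

theorem sum_eq {M : Type*} [AddCommMonoid M] (hb : IsMUBSystem b)
    (hC : (C : Set OP2) = Set.range fun p : Fin 13 × Fin 3 => b p.1 p.2) (F : OP2 → M) :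
    ∑ x ∈ C, F x = ∑ i, ∑ s, F (b i s) := by
  classical
  have : C = Finset.univ.image fun p : Fin 13 × Fin 3 => b p.1 p.2 := by
    rw [← Finset.coe_inj, hC]; simp
  rw [this, Finset.sum_image hb.injective.injOn, Fintype.sum_prod_type]

theorem card_eq (hb : IsMUBSystem b)
    (hC : (C : Set OP2) = Set.range fun p : Fin 13 × Fin 3 => b p.1 p.2) : C.card = 39 := by
  rw [Finset.card_eq_sum_ones, hb.sum_eq hC]; simp

theorem sum_sum_eq (hb : IsMUBSystem b)
    (hC : (C : Set OP2) = Set.range fun p : Fin 13 × Fin 3 => b p.1 p.2) (F : ℝ → ℝ) :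
    ∑ x ∈ C, ∑ y ∈ C, F (x.innerProd y) = 39 * (F 1 + 2 * F 0 + 36 * F (1 / 3)) := by
  simp only [hb.sum_eq hC, hb.sum_comp_innerProd F]
  simp
  ring

theorem isDesign (hb : IsMUBSystem b)
    (hC : (C : Set OP2) = Set.range fun p : Fin 13 × Fin 3 => b p.1 p.2) : IsDesign 2 C := by
  have h1 : ∀ y : OP2, ∑ x ∈ C, (x.innerProd y - 1 / 3) = 0 := by
    intro y
    -- Its square norm is `39 (2/3 - 2/3 + 0)`.
    have h0 : ∑ x ∈ C, x.coord = 0 := by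
      rw [← dotProduct_self_eq_zero, sum_coord_dotProduct, hb.sum_sum_eq hC fun t => t - 1 / 3]
      norm_num
    have := sum_coord_dotProduct C {y}
    simpa [h0] using this.symm
  have h2 : ∀ y : OP2, ∑ x ∈ C, (x.innerProd y - 1 / 3) ^ 2 = 2 / 3 := by
    intro y
    -- The frame constant is `1`: the square norms sum to `39 · 2/3 = 26`, the dimension, and the
    -- squared inner products sum to `39 (4/9 + 2/9) = 26`.
    have := sum_sq_dotProduct_eq C coord 1 ?_ ?_ y.coord
    · simp only [coord_dotProduct, innerProd_self] at this
      rw [this]; norm_num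
    · simp only [coord_dotProduct]
      rw [hb.sum_sum_eq hC fun t => (t - 1 / 3) ^ 2]
      norm_num
    · simp only [coord_dotProduct, innerProd_self, Finset.sum_const, hb.card_eq hC]
      norm_num
  intro k hk hk2 f hf
  induction hf using Submodule.span_induction with
  | zero => simp
  | add f g _ _ hf hg => simp [Finset.sum_add_distrib, hf, hg]
  | smul r f _ hf => simp [← Finset.mul_sum, hf]
  | mem f hf =>
    obtain ⟨y, rfl⟩ := hf
    simp only [cos_geodesicDist]
    interval_cases k
    · simp only [zonal_one, ← Finset.mul_sum, h1, mul_zero]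
    · simp only [zonal_two, Finset.sum_sub_distrib, ← Finset.mul_sum, h2]
      rw [← Finset.sum_sub_distrib, h1, Finset.sum_const, hb.card_eq hC]
      norm_num

theorem isTightCode (hb : IsMUBSystem b)
    (hC : (C : Set OP2) = Set.range fun p : Fin 13 × Fin 3 => b p.1 p.2) : IsTightCode C := by
  -- The bounding polynomial is `t (t - 1/3)` with `t = (z + 1)/2`; the vector lists its zonal
  -- coefficients. The wrap-around of `Fin.ofNat` is harmless, since only `k ≤ 2` occurs.
  have hz : ∀ z : ℝ, ∑ k ∈ Finset.range (2 + 1),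
      (![2 / 117, 2 / 63, 1 / 91] : Fin 3 → ℝ) (Fin.ofNat 3 k) * zonal k z =
      (z + 1) / 2 * ((z + 1) / 2 - 1 / 3) := by
    intro z
    obtain ⟨t, rfl⟩ : ∃ t, z = 2 * t - 1 := ⟨(z + 1) / 2, by ring⟩
    simp only [Finset.sum_range_succ, Finset.sum_range_zero, zonal_zero, zonal_one, zonal_two]
    simp [Fin.ofNat]
    ring
  -- Inner product `1/3` corresponds to `cos ϑ = -1/3`, and `f(1) / c_0 = (2/3) / (2/117) = 39`.
  refine ⟨Real.arccos (-1 / 3), ⟨Real.arccos_nonneg _, Real.arccos_le_pi _⟩, 2,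
    fun k => (![2 / 117, 2 / 63, 1 / 91] : Fin 3 → ℝ) (Fin.ofNat 3 k), ?_, ?_, ?_, ?_, ?_⟩
  · norm_num [Fin.ofNat]
  · intro k _ _
    interval_cases k <;> norm_num [Fin.ofNat]
  · intro z hz'
    rw [Real.cos_arccos (by norm_num) (by norm_num)] at hz'
    rw [hz]
    exact mul_nonpos_of_nonneg_of_nonpos (by linarith [hz'.1]) (by linarith [hz'.2])
  · intro x hx y hy hxy
    rw [← Finset.mem_coe, hC] at hx hy
    obtain ⟨⟨i, s⟩, rfl⟩ := hx
    obtain ⟨⟨j, t⟩, rfl⟩ := hy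
    refine Real.antitone_arccos ?_
    dsimp only
    by_cases hij : i = j
    · subst hij
      rw [hb.1 i s t (by rintro rfl; exact hxy rfl)]; norm_num
    · rw [hb.2 i j hij]; norm_num
  · rw [hz, hb.card_eq hC]
    norm_num [Fin.ofNat]

theorem isUniversallyOptimal (hb : IsMUBSystem b)
    (hC : (C : Set OP2) = Set.range fun p : Fin 13 × Fin 3 => b p.1 p.2) :
    IsUniversallyOptimal C := by
  intro f hf D hD
  obtain ⟨A, B, G, hB, hG, h, h1, h2⟩ := hf.exists_quadratic_minorant
  have hle := le_energy hB hG h D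
  rw [hD, hb.card_eq hC] at hle
  -- The uncontrolled value `f 0` cancels. In the lower bound `G` drops out at 39 points, and both
  -- sides become `39 (38 A + 12 B)`.
  rw [energy_eq, hb.sum_sum_eq hC fun t => f (1 - t), hb.card_eq hC]
  norm_num at hle h1 h2 ⊢
  rw [h1, h2]
  linarith

end IsMUBSystem

/-! ### Points of `OP²` spanned by vectors. -/

open Octonion

theorem rankOne_smul_apply (v : Fin 3 → Octonion) (i j : Fin 3) :
    rankOne ((1 / Real.sqrt 3) • v) i j = (1 / 3 : ℝ) • (v i * star (v j)) := by
  simp only [rankOne, Matrix.of_apply, Pi.smul_apply, star_smul', smul_mul, mul_smul', smul_smul]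
  congr 1
  rw [div_mul_div_comm, Real.mul_self_sqrt (by norm_num), one_mul]

theorem rankOne_isHermitian (v : Fin 3 → Octonion) : (rankOne v).IsHermitian := by
  ext1 i j
  simp [rankOne, Matrix.conjTranspose_apply, Octonion.star_mul', Octonion.star_star']

/-- The point of `OP²` spanned by a standard basis vector. -/
noncomputable def OP2.single (i : Fin 3) : OP2 :=
  ⟨rankOne (Pi.single i 1), rankOne_isHermitian _, by
    ext1 j k
    fin_cases i <;> fin_cases j <;> fin_cases k <;>
      simp [rankOne, Matrix.mul_apply, Fin.sum_univ_three, star_one', star_zero'], by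
    fin_cases i <;> simp [rankOne, Matrix.trace, Fin.sum_univ_three, star_one', star_zero']⟩

theorem mul_star_mul_mul_star {p q : Octonion} (hp : p.normSq = 1) (hq : q.normSq = 1) :
    (p * star q) * (q * star p) = 1 := by
  have := mul_star_self (p * star q)
  rwa [normSq_mul, normSq_star, hp, hq, mul_one, one_smul, Octonion.star_mul', star_star'] at this

/-- The point of `OP²` spanned by `(1, p, q) / √3`. -/
noncomputable def OP2.ofUnits (p q : Octonion) (hp : p.normSq = 1) (hq : q.normSq = 1) : OP2 :=
  ⟨rankOne ((1 / Real.sqrt 3) • ![1, p, q]), rankOne_isHermitian _, by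
    -- Each of the three terms `(v_i v̄_k)(v_k v̄_j)` equals `v_i v̄_j`. Since the first coordinate
    -- is `1`, only `p` and `q` enter, and the alternative laws suffice.
    have e : ∀ x : Octonion, (1 / 3 : ℝ) • (1 / 3 : ℝ) • (x + x + x) = (1 / 3 : ℝ) • x :=
      fun x => by module
    have h1 := mul_star_mul_mul_star hp hq
    have h2 := mul_star_mul_mul_star hq hp
    have a1 := star_mul_mul p (star q)
    have a2 := star_mul_mul q (star p)
    have a3 := mul_star_mul_self p q
    have a4 := mul_star_mul_self q p
    have a5 := mul_star_self p
    have a6 := mul_star_self q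
    have a7 := star_mul_self p
    have a8 := star_mul_self q
    simp only [hp, hq, one_smul] at a1 a2 a3 a4 a5 a6 a7 a8
    ext1 j k
    simp only [Matrix.mul_apply, Fin.sum_univ_three, rankOne_smul_apply, smul_mul, mul_smul',
      ← smul_add]
    refine Eq.trans ?_ (e _)
    congr 2
    fin_cases j <;> fin_cases k <;>
      simp [star_one', h1, h2, a1, a2, a3, a4, a5, a6, a7, a8], by
    simp only [Matrix.trace, Matrix.diag_apply, Fin.sum_univ_three, rankOne_smul_apply]
    simp only [Matrix.cons_val_zero, Matrix.cons_val_one, Matrix.cons_val, star_one',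
      mul_star_self, hp, hq, one_mul, one_smul]
    module⟩

namespace OP2

theorem innerProd_single_single {i j : Fin 3} (h : i ≠ j) :
    (single i).innerProd (single j) = 0 := by
  rw [innerProd_eq_sum]
  refine Finset.sum_eq_zero fun k _ => Finset.sum_eq_zero fun l _ => ?_
  simp only [single, rankOne, Matrix.of_apply]
  by_cases hk : k = i
  · rw [Pi.single_eq_of_ne (i := j) (hk.trans_ne h), zero_mul]; simp [dot]
  · rw [Pi.single_eq_of_ne (i := i) hk, zero_mul]; simp [dot]

theorem innerProd_single (i : Fin 3) (x : OP2) : (single i).innerProd x = x.diag i := by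
  have h1 : ∀ j, (single i).diag j = if j = i then 1 else 0 := by
    intro j
    by_cases h : j = i
    · simp [diag, single, rankOne, h, star_one', re]
    · simp [diag, single, rankOne, h, star_zero', re]
  have h2 : ∀ j k, j ≠ k → (single i).1 j k = 0 := by
    intro j k h
    refine normSq_eq_zero ?_
    rw [normSq_apply _ h, h1, h1]
    split_ifs with h3 h4 <;> simp
    exact h (h3.trans h4.symm)
  obtain ⟨j, k, hij, hjk, hik⟩ : ∃ j k, i ≠ j ∧ j ≠ k ∧ i ≠ k := by clear * -; revert i; decide
  rw [innerProd_eq _ x hij hjk hik, h2 i j hij, h2 j k hjk, h2 k i hik.symm, h1, h1, h1,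
    if_pos rfl, if_neg hij.symm, if_neg hik.symm]
  simp [dot]

section

variable (p q p' q' : Octonion) (hp : p.normSq = 1) (hq : q.normSq = 1)
  (hp' : p'.normSq = 1) (hq' : q'.normSq = 1)

theorem ofUnits_apply (i j : Fin 3) :
    (ofUnits p q hp hq).1 i j = (1 / 3 : ℝ) • (![1, p, q] i * star (![1, p, q] j)) :=
  rankOne_smul_apply _ i j

theorem diag_ofUnits (i : Fin 3) : (ofUnits p q hp hq).diag i = 1 / 3 := by
  rw [diag, ofUnits_apply, mul_star_self]
  have : (![1, p, q] i).normSq = 1 := by fin_cases i <;> simp [normSq_one, hp, hq]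
  rw [this]
  simp [re]

theorem innerProd_ofUnits :
    (ofUnits p q hp hq).innerProd (ofUnits p' q' hp' hq') =
      (3 + 2 * dot p p' + 2 * dot q q' + 2 * dot (p * star q) (p' * star q')) / 9 := by
  rw [innerProd_eq _ _ (i := 0) (j := 1) (k := 2) (by decide) (by decide) (by decide)]
  simp only [diag_ofUnits, ofUnits_apply, dot_smul_left, dot_smul_right]
  simp only [Matrix.cons_val_zero, Matrix.cons_val_one, Matrix.cons_val, star_one', one_mul,
    mul_one, dot_star_star]
  ring

end

end OP2

/-! ### Complex lines in the octonions and cube roots of unity. -/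

/-- Units spanning the four complex lines of the octonions. -/
noncomputable def lineUnit : Fin 4 → Octonion := ![1, unitJ, unitL, unitN]

theorem ofComplex_coords (z : ℂ) :
    (ofComplex z).fst.re = z.re ∧ (ofComplex z).fst.imI = z.im ∧ (ofComplex z).fst.imJ = 0 ∧
      (ofComplex z).fst.imK = 0 ∧ (ofComplex z).snd = 0 := by simp [ofComplex]

theorem unitJ_coords : unitJ.fst.re = 0 ∧ unitJ.fst.imI = 0 ∧ unitJ.fst.imJ = 1 ∧
    unitJ.fst.imK = 0 ∧ unitJ.snd = 0 := ⟨rfl, rfl, rfl, rfl, rfl⟩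

theorem unitL_coords : unitL.fst = 0 ∧ unitL.snd = 1 := ⟨rfl, rfl⟩

theorem dot_ofComplex_mul_lineUnit (z w : ℂ) (m m' : Fin 4) :
    dot (ofComplex z * lineUnit m) (ofComplex w * lineUnit m') =
      if m = m' then (z * star w).re else 0 := by
  fin_cases m <;> fin_cases m' <;>
    simp [lineUnit, unitN, ofComplex_coords, unitJ_coords, unitL_coords, dot]

theorem normSq_ofComplex_mul_lineUnit (z : ℂ) (m : Fin 4) :
    (ofComplex z * lineUnit m).normSq = Complex.normSq z := by
  rw [← dot_self, dot_ofComplex_mul_lineUnit, if_pos rfl]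
  simp [Complex.normSq_apply]

theorem unitPairs_eq (m : Fin 4) :
    unitPairs m = (lineUnit m, lineUnit (![0, 2, 3, 1] m)) := by
  fin_cases m <;> rfl

/-- The units `j, ℓ, n` multiply cyclically, so the product of two of their lines lies in the third.
It is conjugate-linear in both factors for `m ≠ 0`, which is why the phase below is `a + b` there
and `a - b` for `m = 0`. -/
theorem ofComplex_mul_mul_star (z w : ℂ) (m : Fin 4) :
    (ofComplex z * lineUnit m) * star (ofComplex w * lineUnit (![0, 2, 3, 1] m)) =
      ofComplex (if m = 0 then z * star w else - star (z * w)) *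
        lineUnit (![0, 3, 1, 2] m) := by
  fin_cases m <;> ext <;>
    simp [lineUnit, unitN, ofComplex_coords, unitJ_coords, unitL_coords] <;> ring

/-- The powers of `exp (2πi/3)`, indexed by residues modulo `3`. -/
noncomputable def cubeRoot (a : Fin 3) : ℂ := Complex.exp (2 * Real.pi * Complex.I / 3) ^ (a : ℕ)

theorem isPrimitiveRoot_cubeRoot :
    IsPrimitiveRoot (Complex.exp (2 * Real.pi * Complex.I / 3)) 3 :=
  Complex.isPrimitiveRoot_exp 3 (by norm_num)

theorem cubeRoot_add (a b : Fin 3) : cubeRoot (a + b) = cubeRoot a * cubeRoot b := by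
  rw [cubeRoot, cubeRoot, cubeRoot, Fin.val_add, ← pow_add]
  conv_rhs => rw [← Nat.mod_add_div (a + b : ℕ) 3, pow_add, pow_mul,
    isPrimitiveRoot_cubeRoot.pow_eq_one, one_pow, mul_one]

theorem normSq_cubeRoot (a : Fin 3) : Complex.normSq (cubeRoot a) = 1 := by
  rw [cubeRoot, map_pow, Complex.normSq_eq_norm_sq,
    isPrimitiveRoot_cubeRoot.norm'_eq_one (by norm_num)]
  norm_num

theorem star_cubeRoot (a : Fin 3) : star (cubeRoot a) = cubeRoot (-a) := by
  have h0 : cubeRoot 0 = 1 := by simp [cubeRoot]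
  have h : cubeRoot a * cubeRoot (-a) = 1 := by rw [← cubeRoot_add, add_neg_cancel, h0]
  have h' : star (cubeRoot a) * cubeRoot a = 1 := by
    rw [mul_comm, Complex.star_def, Complex.mul_conj, normSq_cubeRoot, Complex.ofReal_one]
  exact left_inv_eq_right_inv h' h

theorem re_cubeRoot (a : Fin 3) : (cubeRoot a).re = if a = 0 then 1 else -(1 / 2) := by
  have h1 : (cubeRoot 1).re = -(1 / 2) := by
    have : (2 * Real.pi * Complex.I / 3 : ℂ) = ((2 * Real.pi / 3 : ℝ) : ℂ) * Complex.I := by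
      push_cast; ring
    rw [cubeRoot, this, Fin.val_one, pow_one, Complex.exp_ofReal_mul_I_re,
      show 2 * Real.pi / 3 = Real.pi - Real.pi / 3 by ring, Real.cos_pi_sub, Real.cos_pi_div_three]
  have h2 : (cubeRoot 2).re = -(1 / 2) := by
    rw [← h1, show (2 : Fin 3) = -1 from rfl, ← star_cubeRoot, Complex.star_def, Complex.conj_re]
  fin_cases a
  · simp [cubeRoot]
  · simpa using h1
  · simpa using h2

theorem omegaPow_eq (a : Fin 3) : omegaPow a = ofComplex (cubeRoot a) := rfl

theorem normSq_omegaPow_mul (a : Fin 3) (m : Fin 4) :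
    (omegaPow a * (unitPairs m).1).normSq = 1 ∧ (omegaPow a * (unitPairs m).2).normSq = 1 := by
  simp only [unitPairs_eq, omegaPow_eq, normSq_ofComplex_mul_lineUnit, normSq_cubeRoot, and_self]

/-! ### Inner products in the explicit code and its 13 bases. -/

/-- The point of the code spanned by `(1, ω ^ a p, ω ^ b q) / √3`. -/
noncomputable def codePoint (m : Fin 4) (a b : Fin 3) : OP2 :=
  ofUnits (omegaPow a * (unitPairs m).1) (omegaPow b * (unitPairs m).2)
    (normSq_omegaPow_mul a m).1 (normSq_omegaPow_mul b m).2

theorem innerProd_single_codePoint (i : Fin 3) (m : Fin 4) (a b : Fin 3) :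
    (single i).innerProd (codePoint m a b) = 1 / 3 := by
  rw [innerProd_single, codePoint, diag_ofUnits]

/-- The lines containing `p`, `q` and `p q̄` are each permuted by `m`, so all three cross terms in
`innerProd_ofUnits` pair orthogonal lines, leaving `3/9`. -/
theorem innerProd_codePoint_of_ne {m m' : Fin 4} (h : m ≠ m') (a b a' b' : Fin 3) :
    (codePoint m a b).innerProd (codePoint m' a' b') = 1 / 3 := by
  have h1 : (![0, 2, 3, 1] : Fin 4 → Fin 4) m ≠ ![0, 2, 3, 1] m' := by
    revert m m'; decide
  have h2 : (![0, 3, 1, 2] : Fin 4 → Fin 4) m ≠ ![0, 3, 1, 2] m' := by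
    revert m m'; decide
  simp only [codePoint, innerProd_ofUnits, unitPairs_eq, omegaPow_eq, ofComplex_mul_mul_star,
    dot_ofComplex_mul_lineUnit, if_neg h, if_neg h1, if_neg h2]
  norm_num

/-- The index of the basis containing `codePoint m a b` among those with the same `m`. -/
def baseIndex (m : Fin 4) (a b : Fin 3) : Fin 3 := if m = 0 then a + b else b - a

/-- The residue that, with `a` and `b`, governs inner products of code points with the same `m`. -/
def phase (m : Fin 4) (a b : Fin 3) : Fin 3 := if m = 0 then a - b else a + b

/-- Each cross term is the real part of a cube root of unity, `(3δ - 1)/2` with `δ` the indicator of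
coincidence. -/
theorem innerProd_codePoint_self (m : Fin 4) (a b a' b' : Fin 3) :
    (codePoint m a b).innerProd (codePoint m a' b') =
      ((if a = a' then 1 else 0) + (if b = b' then 1 else 0) +
        (if phase m a b = phase m a' b' then 1 else 0)) / 3 := by
  have hre : ∀ c d : Fin 3, (cubeRoot c * star (cubeRoot d)).re =
      (3 * (if c = d then 1 else 0) - 1) / 2 := by
    intro c d
    rw [star_cubeRoot, ← cubeRoot_add, re_cubeRoot, ← sub_eq_add_neg]
    simp only [sub_eq_zero]
    split_ifs <;> norm_num
  have h3 : ((if m = 0 then cubeRoot a * star (cubeRoot b) else -star (cubeRoot a * cubeRoot b)) *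
      star (if m = 0 then cubeRoot a' * star (cubeRoot b')
        else -star (cubeRoot a' * cubeRoot b'))).re =
      (3 * (if phase m a b = phase m a' b' then 1 else 0) - 1) / 2 := by
    rw [← hre]
    by_cases hm : m = 0
    · simp only [hm, phase, if_true, star_cubeRoot b, star_cubeRoot b', ← cubeRoot_add,
        ← sub_eq_add_neg]
    · simp only [hm, phase, if_false, ← cubeRoot_add, star_neg, neg_mul_neg, star_star]
      rw [← Complex.conj_re]
      simp
  simp only [codePoint, innerProd_ofUnits, unitPairs_eq, omegaPow_eq, ofComplex_mul_mul_star,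
    dot_ofComplex_mul_lineUnit, if_true, h3, hre]
  ring

/-- The bases of the code. -/
noncomputable def codeBasis : Option (Fin 4 × Fin 3) → Fin 3 → OP2
  | none, s => single s
  | some (m, c), s => codePoint m s (if m = 0 then c - s else c + s)

theorem codeBasis_baseIndex (m : Fin 4) (a b : Fin 3) :
    codeBasis (some (m, baseIndex m a b)) a = codePoint m a b := by
  simp only [codeBasis, baseIndex]
  congr 1
  split_ifs <;> abel

/-- For fixed `m`, the functions `a`, `b`, `phase` and `baseIndex` cut out the four parallel classes
of lines in `𝔽₃²`. Two distinct points share exactly one line: if it is a `baseIndex` line none of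
the three indicators fires, otherwise exactly one does. -/
theorem isMUBSystem_codeBasis : IsMUBSystem codeBasis := by
  constructor
  · rintro (_ | ⟨m, c⟩) s t hst
    · exact innerProd_single_single hst
    · have h : (if m = 0 then c - s else c + s) ≠ (if m = 0 then c - t else c + t) := by
        split_ifs <;> simpa using hst
      have h' : phase m s (if m = 0 then c - s else c + s) ≠
          phase m t (if m = 0 then c - t else c + t) := by
        simp only [phase]
        split_ifs <;> clear * - hst <;> revert s t c <;> decide
      simp only [codeBasis, innerProd_codePoint_self, if_neg hst, if_neg h, if_neg h']
      norm_num
  · rintro (_ | ⟨m, c⟩) (_ | ⟨m', c'⟩) hij s t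
    · exact absurd rfl hij
    · exact innerProd_single_codePoint _ _ _ _
    · exact (innerProd_comm _ _).trans (innerProd_single_codePoint _ _ _ _)
    · by_cases hm : m = m'
      · subst hm
        have hc : c ≠ c' := by rintro rfl; exact hij rfl
        simp only [codeBasis, innerProd_codePoint_self]
        -- Only whether `m = 0` matters; `z` encodes this, making the statement a small finite
        -- check.
        have key : ∀ z : Fin 2, ∀ c c' s t : Fin 3, c ≠ c' →
            (if s = t then 1 else 0) +
            (if (if z = 0 then c - s else c + s) = (if z = 0 then c' - t else c' + t)
              then 1 else 0) +
            (if (if z = 0 then s - (c - s) else s + (c + s)) =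
              (if z = 0 then t - (c' - t) else t + (c' + t)) then 1 else 0) = 1 := by decide
        have key' := key (if m = 0 then 0 else 1) c c' s t hc
        have := congrArg (fun n : ℕ => (n : ℝ)) key'
        by_cases hm : m = 0 <;> simp [hm, phase] at this ⊢ <;> rw [this] <;> norm_num
      · exact innerProd_codePoint_of_ne hm _ _ _ _

theorem range_codeBasis :
    (fun x : OP2 => x.1) '' (Set.range fun p : Option (Fin 4 × Fin 3) × Fin 3 =>
      codeBasis p.1 p.2) = explicitMatrices := by
  apply Set.Subset.antisymm
  · rintro _ ⟨_, ⟨⟨_ | ⟨m, c⟩, s⟩, rfl⟩, rfl⟩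
    · exact Or.inl ⟨s, rfl⟩
    · exact Or.inr ⟨m, s, _, rfl⟩
  · rintro _ (⟨s, rfl⟩ | ⟨m, a, b, rfl⟩)
    · exact ⟨_, ⟨(none, s), rfl⟩, rfl⟩
    · exact ⟨_, ⟨(some (m, baseIndex m a b), a), codeBasis_baseIndex m a b⟩, rfl⟩

theorem mainTheorem3 :
    ∃ (C : Finset OP2) (b : Fin 13 → Fin 3 → OP2),
      -- the code is the explicit one, and has 39 points
      (fun x : OP2 => x.1) '' (C : Set OP2) = explicitMatrices ∧
      C.card = 39 ∧
      -- it is the disjoint union of the 13 triples `b i`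
      Function.Injective (fun p : Fin 13 × Fin 3 => b p.1 p.2) ∧
      (C : Set OP2) = Set.range (fun p : Fin 13 × Fin 3 => b p.1 p.2) ∧
      -- inner products and distances
      (∀ i s t, s ≠ t → (b i s).innerProd (b i t) = 0) ∧
      (∀ i j, i ≠ j → ∀ s t, (b i s).innerProd (b j t) = 1 / 3) ∧
      (∀ i j, i ≠ j → ∀ s t, (b i s).chordalDist (b j t) = Real.sqrt (2 / 3)) ∧
      -- the triples form a system of mutually unbiased bases of the largest possible size
      IsMUBSystem b ∧
      (∀ (N : ℕ) (b' : Fin N → Fin 3 → OP2), IsMUBSystem b' → N ≤ 13) ∧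
      -- design property, tightness, universal optimality
      IsDesign 2 C ∧
      IsTightCode C ∧
      IsUniversallyOptimal C := by
  classical
  let e : Fin 13 ≃ Option (Fin 4 × Fin 3) := (Fintype.equivFinOfCardEq (by decide)).symm
  let b : Fin 13 → Fin 3 → OP2 := fun i => codeBasis (e i)
  have hb : IsMUBSystem b := ⟨fun i => isMUBSystem_codeBasis.1 (e i), fun i j hij =>
    isMUBSystem_codeBasis.2 _ _ (e.injective.ne hij)⟩
  let C : Finset OP2 := Finset.univ.image fun p : Fin 13 × Fin 3 => b p.1 p.2
  have hC : (C : Set OP2) = Set.range fun p : Fin 13 × Fin 3 => b p.1 p.2 := by simp [C]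
  refine ⟨C, b, ?_, hb.card_eq hC, hb.injective, hC, hb.1, hb.2, ?_, hb, ?_, hb.isDesign hC,
    hb.isTightCode hC, hb.isUniversallyOptimal hC⟩
  · rw [← range_codeBasis, hC]
    congr 1
    exact (e.prodCongr (Equiv.refl (Fin 3))).surjective.range_comp
      fun p : Option (Fin 4 × Fin 3) × Fin 3 => codeBasis p.1 p.2
  · intro i j hij s t
    rw [chordalDist_eq, hb.2 i j hij]
    norm_num
  · intro N b' hb'
    simpa using hb'.card_le
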